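/- Let $d\ge 1$. For $\theta=(\theta_1,\dots,\theta_d)\in(\mathbb{R}/2\pi\mathbb{Z})^d$ let $|\theta\rangle=\frac{1}{\sqrt d}\sum_{k=1}^d e^{i\theta_k}|k\rangle\in\mathbb{C}^d$, let $\rho_\theta=|\theta\rangle\langle\theta|$ be the corresponding maximally coherent state, and let $\mu$ be the Haar probability measure on the torus $(\mathbb{R}/2\pi\mathbb{Z})^d$. Let $F(\rho,\sigma)=\big(\mathrm{tr}\sqrt{\sqrt\rho\,\sigma\sqrt\rho}\big)^2$ denote the fidelity, and let $\mathcal{E}_{\mathrm{ideal}}(\rho_\theta)=\rho_\theta\otimes\rho_\theta$ be the ideal $1\to2$ phase-covariant cloner. For every completely positive trace-preserving linear map $\mathcal{E}:M_d(\mathbb{C})\to M_d(\mathbb{C})\otimes M_d(\mathbb{C})$ the function $\theta\mapsto F\big(\rho_\theta\otimes\rho_\theta,\mathcal{E}(\rho_\theta)\big)$ is $\mu$-integrable, and the optimal process fidelity is $$\max_{\mathcal{E}\ \mathrm{CPTP}}\ \int F\big(\rho_\theta\otimes\rho_\theta,\ \mathcal{E}(\rho_\theta)\big)\,d\mu(\theta)=\frac{2d-1}{d^2},$$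 where the maximum is over all such maps $\mathcal{E}$ and is attained. -/

import Mathlib

open MeasureTheory
open scoped ComplexOrder MatrixOrder Matrix.Norms.L2Operator CStarAlgebra Kronecker

noncomputable section

namespace QuantumCloning

/-- The fidelity `F(ρ, σ) = (tr √(√ρ σ √ρ))²` (for density matrices the trace is real). -/
def fidelity {n : Type*} [Fintype n] [DecidableEq n] (ρ σ : Matrix n n ℂ) : ℝ :=
  (CFC.sqrt (CFC.sqrt ρ * σ * CFC.sqrt ρ)).trace.re ^ 2

/-- A quantum channel between matrix algebras: a completely positive trace-preserving
linear map. -/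
structure Channel (n m : Type*) [Fintype n] [DecidableEq n] [Fintype m] [DecidableEq m]
    extends CompletelyPositiveMap (Matrix n n ℂ) (Matrix m m ℂ) where
  /-- Trace preservation. -/
  trace_map' : ∀ X : Matrix n n ℂ, (toFun X).trace = X.trace

instance {n m : Type*} [Fintype n] [DecidableEq n] [Fintype m] [DecidableEq m] :
    CoeFun (Channel n m) (fun _ => Matrix n n ℂ → Matrix m m ℂ) :=
  ⟨fun E => E.toFun⟩

/-- The process fidelity between an ideal map (an arbitrary, possibly nonlinear function) and a
channel on the family of states `g ↦ state g` that is parametrized by a group `G` with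
normalized Haar measure `μ`. -/
def processFidelity {G n m : Type*} [MeasurableSpace G] [Fintype n] [DecidableEq n]
    [Fintype m] [DecidableEq m] (μ : Measure G) (state : G → Matrix n n ℂ)
    (ideal : Matrix n n ℂ → Matrix m m ℂ) (E : Channel n m) : ℝ :=
  ∫ g, fidelity (ideal (state g)) (E (state g)) ∂μ

instance : Fact (0 < 2 * Real.pi) := ⟨Real.two_pi_pos⟩

/-- The group of `d`-tuples of angles modulo `2π`. -/
abbrev Phases (d : ℕ) : Type := Fin d → AddCircle (2 * Real.pi)

/-- The Haar probability measure on the `d`-torus. -/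
def phaseHaar (d : ℕ) : Measure (Phases d) :=
  Measure.pi fun _ => AddCircle.haarAddCircle

/-- The vector `|θ⟩ = d^(-1/2) ∑ₖ exp(i θₖ) |k⟩`. -/
def phaseKet (d : ℕ) (θ : Phases d) : Fin d → ℂ :=
  fun k => ((Real.sqrt d)⁻¹ : ℂ) * (AddCircle.toCircle (θ k) : ℂ)

/-- The maximally coherent pure state `|θ⟩⟨θ|`. -/
def phaseState (d : ℕ) (θ : Phases d) : Matrix (Fin d) (Fin d) ℂ :=
  Matrix.vecMulVec (phaseKet d θ) (star (phaseKet d θ))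

/-- The ideal `1 → 2` cloner `ρ ↦ ρ ⊗ ρ`. -/
def idealCloner (d : ℕ) (ρ : Matrix (Fin d) (Fin d) ℂ) :
    Matrix (Fin d × Fin d) (Fin d × Fin d) ℂ :=
  ρ ⊗ₖ ρ

end QuantumCloning

end

/-!
A channel has a Kraus form `E X = ∑ q, K q * X * (K q)ᴴ` (`Channel.exists_kraus`), and the fidelity
with the pure state `|θ, θ⟩` is an expectation value, so the fidelity at `θ` equals
`∑ q, ‖⟨θ, θ| K q |θ⟩‖ ^ 2`. The amplitude `⟨θ, θ| K |θ⟩` is `d ^ (-3 / 2)` times the trigonometric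
polynomial with coefficients `⟨k, l| K |m⟩` and frequencies `e_m - e_k - e_l`
(`fidelity_phaseState_kraus`). In particular the fidelity is continuous in `θ`, hence integrable.

By Parseval, averaging over `θ` leaves only the products of coefficients with equal frequency. The
most frequent frequencies are the `-e_j`, shared by the `2 d - 1` triples with `(k, l)` equal to
`(m, j)` or `(j, m)` (`card_transitionMode_le`). Since trace preservation makes the squared
coefficients sum to `d`, the average is at most `d ^ (-3) * (2 d - 1) * d = (2 d - 1) / d ^ 2`
(`processFidelity_le`).

Equality holds for the Kraus operators `K j`, with `j` ranging over the `d` basis labels, that put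
equal weight on all transitions of frequency `-e_j` and none elsewhere: for them the amplitude is a
multiple of one character, and the fidelity is constant (`processFidelity_optimalCloner`).
-/

namespace QuantumCloning

open Matrix

/-! ### Kraus operators -/

/-- The Mathlib lemma with the real functional calculus of `A` supplied by its C⋆-algebra structure;
in this form it applies to `CStarMatrix`, for which that calculus is not found directly. -/
theorem nonneg_iff_exists_star_mul_self {A : Type*} [NonUnitalCStarAlgebra A] [PartialOrder A]
    [StarOrderedRing A] {a : A} : 0 ≤ a ↔ ∃ y, a = star y * y :=
  CStarAlgebra.nonneg_iff_eq_star_mul_self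

theorem cstarMatrix_sum_apply {A ι κ : Type*} [AddCommMonoid A] (s : Finset κ)
    (f : κ → CStarMatrix ι ι A) (i j : ι) : (∑ q ∈ s, f q) i j = ∑ q ∈ s, f q i j :=
  map_sum (⟨⟨fun M => M i j, rfl⟩, fun _ _ => rfl⟩ : CStarMatrix ι ι A →+ A) f s

/-- Every channel has a Kraus form: the block matrix whose `(i, j)` block is the matrix unit
`single i j 1` is positive, hence so is its image under the channel (the Choi matrix). Writing it
as `star Y * Y`, the Kraus operators are read off from the entries of `Y`. The domain is indexed by
`Fin d` because complete positivity is stated for block matrices indexed by `Fin`. -/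
theorem Channel.exists_kraus {m : Type*} [Fintype m] [DecidableEq m] {d : ℕ} [NeZero d]
    (E : Channel (Fin d) m) :
    ∃ K : Fin d × m → Matrix m (Fin d) ℂ, ∀ X, E X = ∑ q, K q * X * (K q)ᴴ := by
  let M : CStarMatrix (Fin d) (Fin d) (Matrix (Fin d) (Fin d) ℂ) :=
    CStarMatrix.ofMatrix fun i j => Matrix.single i j (1 : ℂ)
  -- `M = star R * R`, where `R` keeps the block row `0` of `M` and is zero elsewhere.
  let R : CStarMatrix (Fin d) (Fin d) (Matrix (Fin d) (Fin d) ℂ) :=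
    CStarMatrix.ofMatrix fun i j => if i = 0 then Matrix.single 0 j (1 : ℂ) else 0
  have hM : 0 ≤ M := by
    have : M = star R * R := by
      ext1 i j
      have hR : ∀ p a, R p a = if p = 0 then Matrix.single 0 a (1 : ℂ) else 0 := fun _ _ => rfl
      change Matrix.single i j 1 = _
      simp [hR, CStarMatrix.mul_apply, CStarMatrix.star_apply, star_eq_conjTranspose]
    rw [this]
    exact star_mul_self_nonneg R
  have h := E.map_cstarMatrix_nonneg' d M hM
  obtain ⟨Y, hY⟩ := nonneg_iff_exists_star_mul_self.mp h
  refine ⟨fun q => Matrix.of fun s i => star (Y q.1 i q.2 s), fun X => ?_⟩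
  have hsingle : ∀ i j, E (Matrix.single i j 1) = ∑ p, (Y p i)ᴴ * Y p j := by
    intro i j
    have h := congrFun (congrFun hY i) j
    rw [CStarMatrix.mul_apply] at h
    exact h
  have hX : E X = ∑ i, ∑ j, X i j • E (Matrix.single i j 1) := by
    conv_lhs => rw [Matrix.matrix_eq_sum_single X]
    change E.toLinearMap _ = ∑ i, ∑ j, X i j • E.toLinearMap _
    simp only [map_sum, ← map_smul, Matrix.smul_single, smul_eq_mul, mul_one]
  rw [hX]
  ext s t
  simp only [hsingle, Matrix.sum_apply, Matrix.smul_apply, Matrix.mul_apply,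
    Matrix.conjTranspose_apply, smul_eq_mul, Matrix.of_apply, star_star, Fintype.sum_prod_type,
    Finset.mul_sum, Finset.sum_mul]
  -- Both sides are sums over `(i, j, p, r)`, in different orders.
  simp_rw [← Finset.sum_product', Finset.univ_product_univ]
  rw [← Equiv.sum_comp (⟨fun x => (x.2.2.2, x.2.2.1, x.1, x.2.1),
    fun x => (x.2.2.1, x.2.2.2, x.2.1, x.1), fun _ => rfl, fun _ => rfl⟩ :
      Fin d × m × Fin d × Fin d ≃ Fin d × Fin d × Fin d × m)]
  exact Finset.sum_congr rfl fun x _ => by simp; ring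

/-- The channel `X ↦ ∑ q, K q * X * (K q)ᴴ` with Kraus operators `K`. -/
def krausChannel {n m κ : Type*} [Fintype n] [DecidableEq n] [Fintype m]
    [DecidableEq m] [Fintype κ] [Nonempty m]
    (K : κ → Matrix m n ℂ) (hK : ∑ q, (K q)ᴴ * K q = 1) : Channel n m where
  toFun X := ∑ q, K q * X * (K q)ᴴ
  map_add' X Y := by simp [Matrix.mul_add, Matrix.add_mul, Finset.sum_add_distrib]
  map_smul' c X := by simp [Finset.smul_sum]
  map_cstarMatrix_nonneg' k M hM := by
    obtain ⟨Y, rfl⟩ := nonneg_iff_exists_star_mul_self.mp hM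
    -- The blocks `Y p a * (K q)ᴴ` are rectangular, so their rows are taken one at a time and placed
    -- in row `s₀` of a square matrix.
    let s₀ : m := Classical.arbitrary m
    let Z : κ → n → CStarMatrix (Fin k) (Fin k) (Matrix m m ℂ) := fun q t =>
      CStarMatrix.ofMatrix fun p a => Matrix.single s₀ t (1 : ℂ) * Y p a * (K q)ᴴ
    have hres : ∑ t : n, (Matrix.single t s₀ (1 : ℂ) * Matrix.single s₀ t (1 : ℂ)) = 1 := by
      simp [Matrix.sum_single_one]
    have hsum : (∑ q, ∑ t, star (Z q t) * Z q t) =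
        (star Y * Y).map fun X => ∑ q, K q * X * (K q)ᴴ := by
      ext1 a b
      have hZ : ∀ q t p c, Z q t p c = Matrix.single s₀ t (1 : ℂ) * Y p c * (K q)ᴴ :=
        fun _ _ _ _ => rfl
      rw [CStarMatrix.map_apply, CStarMatrix.mul_apply]
      have hcomp : ∀ q t p, star (Z q t p a) * Z q t p b =
          K q * ((Y p a)ᴴ * (Matrix.single t s₀ (1 : ℂ) *
            Matrix.single s₀ t (1 : ℂ)) * Y p b) * (K q)ᴴ := by
        intro q t p
        rw [hZ, hZ, star_eq_conjTranspose]
        simp only [Matrix.conjTranspose_mul, Matrix.conjTranspose_conjTranspose,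
          Matrix.conjTranspose_single, star_one, Matrix.mul_assoc]
      simp only [cstarMatrix_sum_apply, CStarMatrix.mul_apply, CStarMatrix.star_apply, hcomp]
      refine Finset.sum_congr rfl fun q _ => ?_
      rw [Finset.sum_comm]
      simp only [← Matrix.sum_mul, ← Matrix.mul_sum, hres, Matrix.mul_one, star_eq_conjTranspose]
    refine le_of_le_of_eq ?_ hsum
    exact Finset.sum_nonneg fun q _ => Finset.sum_nonneg fun t _ => star_mul_self_nonneg _
  trace_map' X := by
    rw [Matrix.trace_sum]
    simp_rw [Matrix.mul_assoc, Matrix.trace_mul_comm (K _), Matrix.mul_assoc]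
    rw [← Matrix.trace_sum, ← Finset.mul_sum, hK, Matrix.mul_one]

/-! ### Fidelity with a pure state -/

/-- The fidelity with a pure state is the expectation value in that state. -/
theorem fidelity_vecMulVec {n : Type*} [Fintype n] [DecidableEq n] {ψ : n → ℂ}
    (hψ : star ψ ⬝ᵥ ψ = 1) {σ : Matrix n n ℂ} (hσ : σ.PosSemidef) :
    fidelity (vecMulVec ψ (star ψ)) σ = (star ψ ⬝ᵥ σ *ᵥ ψ).re := by
  set P := vecMulVec ψ (star ψ) with hP
  have hP0 : 0 ≤ P := (Matrix.posSemidef_vecMulVec_self_star ψ).nonneg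
  have hPP : P * P = P := by
    rw [hP, Matrix.vecMulVec_mul_vecMulVec, hψ, one_smul]
  have hc := hσ.dotProduct_mulVec_nonneg ψ
  set c := star ψ ⬝ᵥ σ *ᵥ ψ with hcdef
  have hc' : c = (c.re : ℂ) := Complex.eq_re_of_ofReal_le hc
  have hre : 0 ≤ c.re := (Complex.le_def.mp hc).1
  have hPσP : P * σ * P = c • P := by
    rw [hP, Matrix.vecMulVec_mul, Matrix.vecMulVec_mul_vecMulVec, ← Matrix.dotProduct_mulVec]
    simp [hcdef, Matrix.vecMulVec_smul]
  have hsq : (Real.sqrt c.re : ℂ) * (Real.sqrt c.re : ℂ) = c := by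
    rw [← Complex.ofReal_mul, Real.mul_self_sqrt hre, ← hc']
  have hsqrt : CFC.sqrt (P * σ * P) = (Real.sqrt c.re : ℂ) • P := by
    refine CFC.sqrt_unique ?_ ?_
    · rw [smul_mul_smul_comm, hPP, hPσP, hsq]
    · exact smul_nonneg (Complex.zero_le_real.mpr (Real.sqrt_nonneg _)) hP0
  have htr : P.trace = 1 := by
    rw [hP, Matrix.trace_vecMulVec, dotProduct_comm, hψ]
  rw [fidelity, CFC.sqrt_unique hPP hP0, hsqrt, Matrix.trace_smul, htr]
  simp [Real.sq_sqrt hre]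

theorem fidelity_kraus {n m κ : Type*} [Fintype n] [Fintype m] [DecidableEq m] [Fintype κ]
    {φ : n → ℂ} (ψ : m → ℂ) (hψ : star ψ ⬝ᵥ ψ = 1) (K : κ → Matrix m n ℂ) :
    fidelity (vecMulVec ψ (star ψ)) (∑ q, K q * vecMulVec φ (star φ) * (K q)ᴴ) =
      ∑ q, ‖star ψ ⬝ᵥ K q *ᵥ φ‖ ^ 2 := by
  have hterm : ∀ q, K q * vecMulVec φ (star φ) * (K q)ᴴ =
      vecMulVec (K q *ᵥ φ) (star (K q *ᵥ φ)) := fun q => by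
    rw [Matrix.mul_vecMulVec, Matrix.vecMulVec_mul, Matrix.star_mulVec]
  simp_rw [hterm]
  rw [fidelity_vecMulVec hψ (Matrix.posSemidef_sum _ fun q _ =>
    Matrix.posSemidef_vecMulVec_self_star _), Matrix.sum_mulVec, dotProduct_sum, Complex.re_sum]
  refine Finset.sum_congr rfl fun q _ => ?_
  rw [Matrix.vecMulVec_mulVec, dotProduct_smul]
  have : star (K q *ᵥ φ) ⬝ᵥ ψ = star (star ψ ⬝ᵥ K q *ᵥ φ) := by
    rw [Matrix.star_dotProduct]
  rw [this]
  rw [op_smul_eq_mul, ← starRingEnd_apply (_ ⬝ᵥ _), Complex.mul_conj', ← Complex.ofReal_pow,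
    Complex.ofReal_re]

/-! ### Mean squares of trigonometric polynomials on the torus -/

theorem integral_fourier {T : ℝ} [Fact (0 < T)] (k : ℤ) :
    ∫ x : AddCircle T, fourier k x ∂AddCircle.haarAddCircle = if k = 0 then 1 else 0 := by
  have h := orthonormal_iff_ite.mp (orthonormal_fourier (T := T)) 0 k
  rw [ContinuousMap.inner_toLp AddCircle.haarAddCircle (fourier 0) (fourier k)] at h
  simpa [eq_comm] using h

instance (d : ℕ) : IsProbabilityMeasure (phaseHaar d) := by
  unfold phaseHaar; infer_instance

/-- The character `θ ↦ exp (i ∑ j, ν j * θ j)` of the torus with integer frequency vector `ν`. -/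
noncomputable def torusChar {d : ℕ} (ν : Fin d → ℤ) (θ : Phases d) : ℂ := ∏ j, fourier (ν j) (θ j)

@[fun_prop]
theorem continuous_torusChar {d : ℕ} (ν : Fin d → ℤ) : Continuous (torusChar ν) := by
  unfold torusChar; fun_prop

theorem torusChar_add {d : ℕ} (ν ν' : Fin d → ℤ) (θ : Phases d) :
    torusChar (ν + ν') θ = torusChar ν θ * torusChar ν' θ := by
  simp [torusChar, Finset.prod_mul_distrib]

theorem torusChar_neg {d : ℕ} (ν : Fin d → ℤ) (θ : Phases d) :
    torusChar (-ν) θ = star (torusChar ν θ) := by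
  simp only [torusChar, Pi.neg_apply, fourier_neg, star_prod]; rfl

theorem torusChar_single {d : ℕ} (k : Fin d) (θ : Phases d) :
    torusChar (Pi.single k 1) θ = AddCircle.toCircle (θ k) := by
  rw [torusChar, Finset.prod_eq_single k]
  · simp
  · intro j _ hj
    simp [hj]
  · simp

theorem integral_torusChar {d : ℕ} (ν : Fin d → ℤ) :
    ∫ θ, torusChar ν θ ∂phaseHaar d = if ν = 0 then 1 else 0 := by
  simp only [torusChar, phaseHaar]
  rw [integral_fintype_prod_eq_prod (𝕜 := ℂ) fun j x => fourier (ν j) x]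
  simp only [integral_fourier, funext_iff, Pi.zero_apply]
  rw [Finset.prod_ite_zero]
  simp

theorem integrable_of_continuous {d : ℕ} {F : Type*} [NormedAddCommGroup F] {f : Phases d → F}
    (hf : Continuous f) :
    Integrable f (phaseHaar d) :=
  hf.integrable_of_hasCompactSupport (HasCompactSupport.of_compactSpace f)

theorem integral_normSq_sum_torusChar {d : ℕ} {ι : Type*} [Fintype ι] (ν : ι → Fin d → ℤ)
    (c : ι → ℂ) :
    ∫ θ, ‖∑ a, c a * torusChar (ν a) θ‖ ^ 2 ∂phaseHaar d =
      ∑ a, ∑ b, if ν a = ν b then (c a * star (c b)).re else 0 := by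
  have hpt : ∀ θ, (((‖∑ a, c a * torusChar (ν a) θ‖ ^ 2 : ℝ)) : ℂ) =
      ∑ a, ∑ b, c a * star (c b) * torusChar (ν a - ν b) θ := fun θ => by
    rw [Complex.ofReal_pow, ← Complex.mul_conj', map_sum, Finset.sum_mul_sum]
    refine Finset.sum_congr rfl fun a _ => Finset.sum_congr rfl fun b _ => ?_
    rw [sub_eq_add_neg, torusChar_add, torusChar_neg, starRingEnd_apply, star_mul']
    ring
  have hint : ∫ θ, (((‖∑ a, c a * torusChar (ν a) θ‖ ^ 2 : ℝ)) : ℂ) ∂phaseHaar d =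
      ∑ a, ∑ b, if ν a = ν b then c a * star (c b) else 0 := by
    simp_rw [hpt]
    rw [integral_finsetSum _ fun a _ => integrable_of_continuous (by fun_prop)]
    refine Finset.sum_congr rfl fun a _ => ?_
    rw [integral_finsetSum _ fun b _ => integrable_of_continuous (by fun_prop)]
    refine Finset.sum_congr rfl fun b _ => ?_
    rw [integral_const_mul, integral_torusChar]
    simp [sub_eq_zero]
  rw [integral_complex_ofReal] at hint
  have := congrArg Complex.re hint
  rw [Complex.ofReal_re] at this
  rw [this, Complex.re_sum]
  refine Finset.sum_congr rfl fun a _ => ?_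
  rw [Complex.re_sum]
  refine Finset.sum_congr rfl fun b _ => ?_
  split_ifs <;> simp

/-- If every frequency occurs at most `N` times among the `ν a`, then the mean square of the
trigonometric polynomial is at most `N` times the sum of the squared coefficients: by Parseval only
pairs with equal frequency contribute, and for these
`re (c a * star (c b)) ≤ (‖c a‖ ^ 2 + ‖c b‖ ^ 2) / 2`. -/
theorem integral_normSq_sum_torusChar_le {d : ℕ} {ι : Type*} [Fintype ι] (ν : ι → Fin d → ℤ)
    (N : ℕ) (hN : ∀ a, (Finset.univ.filter fun b => ν b = ν a).card ≤ N) (c : ι → ℂ) :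
    ∫ θ, ‖∑ a, c a * torusChar (ν a) θ‖ ^ 2 ∂phaseHaar d ≤ N * ∑ a, ‖c a‖ ^ 2 := by
  rw [integral_normSq_sum_torusChar]
  have hamgm : ∀ a b, (c a * star (c b)).re ≤ (‖c a‖ ^ 2 + ‖c b‖ ^ 2) / 2 := fun a b => by
    have h1 : (c a * star (c b)).re ≤ ‖c a‖ * ‖c b‖ := by
      simpa using Complex.re_le_norm (c a * star (c b))
    nlinarith [sq_nonneg (‖c a‖ - ‖c b‖)]
  calc _ ≤ ∑ a, ∑ b, ((if ν b = ν a then ‖c a‖ ^ 2 / 2 else 0) +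
          if ν a = ν b then ‖c b‖ ^ 2 / 2 else 0) := by
        refine Finset.sum_le_sum fun a _ => Finset.sum_le_sum fun b _ => ?_
        by_cases h : ν a = ν b
        · simpa [h, add_div] using hamgm a b
        · simp [h, Ne.symm h]
    _ = ∑ a, ((Finset.univ.filter fun b => ν b = ν a).card : ℝ) * ‖c a‖ ^ 2 := by
        simp_rw [Finset.sum_add_distrib]
        rw [Finset.sum_comm (f := fun a b => if ν a = ν b then ‖c b‖ ^ 2 / 2 else 0),
          ← Finset.sum_add_distrib]
        refine Finset.sum_congr rfl fun a _ => ?_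
        rw [← Finset.sum_filter, Finset.sum_const, nsmul_eq_mul]
        ring
    _ ≤ N * ∑ a, ‖c a‖ ^ 2 := by
        rw [Finset.mul_sum]
        gcongr with a
        exact hN a

/-! ### Counting transitions with equal frequency -/

/-- The frequency vector `e_m - e_k - e_l` of the phase that the matrix element
`⟨k, l| K |m⟩`, indexed by `((k, l), m)`, acquires in `⟨θ, θ| K |θ⟩`. -/
def transitionMode {d : ℕ} (a : (Fin d × Fin d) × Fin d) : Fin d → ℤ :=
  Pi.single a.2 1 - Pi.single a.1.1 1 - Pi.single a.1.2 1

/-- The set `{(m, j), (j, m)}`, which is a singleton for `m = j`; it consists of the outputs `(k, l)`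
for which the transition from `m` has frequency `-e_j`. -/
def cloningPairs {d : ℕ} (m j : Fin d) : Finset (Fin d × Fin d) := {(m, j), (j, m)}

theorem card_cloningPairs {d : ℕ} (m j : Fin d) :
    (cloningPairs m j).card = if m = j then 1 else 2 := by
  split_ifs with h
  · simp [cloningPairs, h]
  · rw [cloningPairs, Finset.card_pair]
    simp [h]

theorem sum_card_cloningPairs {d : ℕ} (j : Fin d) :
    ∑ m, (cloningPairs m j).card = 2 * d - 1 := by
  have h : ∑ m, ((cloningPairs m j).card + if m = j then 1 else 0) = 2 * d := by
    calc _ = ∑ m : Fin d, 2 := Finset.sum_congr rfl fun m _ => by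
          rw [card_cloningPairs]; split_ifs <;> rfl
      _ = 2 * d := by simp [mul_comm]
  rw [Finset.sum_add_distrib] at h
  simp at h
  omega

theorem mem_cloningPairs_of_transitionMode_eq {d : ℕ} {s : Fin d × Fin d} {m j : Fin d}
    (h : transitionMode (s, m) = -Pi.single j 1) : s ∈ cloningPairs m j := by
  obtain ⟨k, l⟩ := s
  have hp := congrFun h
  simp only [transitionMode, Pi.sub_apply, Pi.neg_apply, Pi.single_apply] at hp
  have h1 := hp k
  have h2 := hp l
  have h3 := hp m
  have h4 := hp j
  simp only [cloningPairs, Finset.mem_insert, Finset.mem_singleton, Prod.mk.injEq]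
  grind

theorem eq_and_mem_cloningPairs_of_transitionMode_eq {d : ℕ} {s s' : Fin d × Fin d} {m m' : Fin d}
    (hk : m ≠ s.1) (hl : m ≠ s.2) (h : transitionMode (s', m') = transitionMode (s, m)) :
    m' = m ∧ s' ∈ cloningPairs s.1 s.2 := by
  obtain ⟨k, l⟩ := s
  obtain ⟨k', l'⟩ := s'
  have hp := congrFun h
  simp only [transitionMode, Pi.sub_apply, Pi.single_apply] at hp
  have h1 := hp k
  have h2 := hp l
  have h3 := hp m
  have h4 := hp m'
  have h5 := hp k'
  have h6 := hp l'
  simp only [cloningPairs, Finset.mem_insert, Finset.mem_singleton, Prod.mk.injEq]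
  grind

/-- No frequency is shared by more than `2 * d - 1` transitions. A frequency `-e_j` occurs only for
`(k, l)` equal to `(m, j)` or `(j, m)`; for any other frequency `e_m - e_k - e_l` the index `m` and
the unordered pair `{k, l}` are determined. -/
theorem card_transitionMode_le {d : ℕ} (a : (Fin d × Fin d) × Fin d) :
    (Finset.univ.filter fun b => transitionMode b = transitionMode a).card ≤ 2 * d - 1 := by
  obtain ⟨s, m⟩ := a
  by_cases hm : m = s.1 ∨ m = s.2
  · obtain ⟨j, hj⟩ : ∃ j, transitionMode (s, m) = -Pi.single j 1 := by
      rcases hm with h | h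
      · exact ⟨s.2, by simp [transitionMode, h]⟩
      · exact ⟨s.1, by simp [transitionMode, h]⟩
    rw [← sum_card_cloningPairs j, ← Finset.card_sigma]
    refine Finset.card_le_card_of_injOn (fun b => ⟨b.2, b.1⟩) ?_ ?_
    · intro b hb
      simp only [Finset.coe_filter, Finset.mem_univ, true_and, Set.mem_ofPred_eq] at hb
      simpa using mem_cloningPairs_of_transitionMode_eq (hb.trans hj)
    · rintro ⟨x, y⟩ _ ⟨x', y'⟩ _ h
      simp at h
      simp [h]
  · push Not at hm
    -- Two transitions fit under `2 * d - 1` because `m` and `s.1` are distinct, which forces `2 ≤ d`.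
    have hd : 2 ≤ d := by
      have := Fintype.one_lt_card_iff_nontrivial.mpr ⟨m, s.1, hm.1⟩
      rwa [Fintype.card_fin] at this
    have hsub : (Finset.univ.filter fun b => transitionMode b = transitionMode (s, m)) ⊆
        cloningPairs s.1 s.2 ×ˢ {m} := by
      rintro ⟨s', m'⟩ hb
      simp only [Finset.mem_filter, Finset.mem_univ, true_and] at hb
      have := eq_and_mem_cloningPairs_of_transitionMode_eq hm.1 hm.2 hb
      simp [this]
    refine (Finset.card_le_card hsub).trans ?_
    rw [Finset.card_product, card_cloningPairs]
    split_ifs <;> simp <;> omega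

/-! ### The fidelity as a trigonometric polynomial -/

/-- The vector `|θ⟩ ⊗ |θ⟩`. -/
noncomputable def clonedKet (d : ℕ) (θ : Phases d) : Fin d × Fin d → ℂ :=
  fun s => phaseKet d θ s.1 * phaseKet d θ s.2

theorem idealCloner_phaseState (d : ℕ) (θ : Phases d) :
    idealCloner d (phaseState d θ) = vecMulVec (clonedKet d θ) (star (clonedKet d θ)) := by
  ext s t
  simp only [idealCloner, phaseState, kroneckerMap_apply, vecMulVec_apply, clonedKet, Pi.star_apply,
    star_mul']
  ring

theorem phaseKet_dotProduct {d : ℕ} [NeZero d] (θ : Phases d) :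
    star (phaseKet d θ) ⬝ᵥ phaseKet d θ = 1 := by
  have hd : (d : ℂ) ≠ 0 := Nat.cast_ne_zero.mpr (NeZero.ne d)
  have hsq : ((Real.sqrt d : ℝ) : ℂ) * (Real.sqrt d : ℝ) = d := by
    rw [← Complex.ofReal_mul, Real.mul_self_sqrt (Nat.cast_nonneg d), Complex.ofReal_natCast]
  have hterm : ∀ k, star (phaseKet d θ k) * phaseKet d θ k = (d : ℂ)⁻¹ := fun k => by
    rw [← starRingEnd_apply, Complex.conj_mul', phaseKet, norm_mul, Circle.norm_coe, mul_one,
      norm_inv, Complex.norm_real, Real.norm_of_nonneg (Real.sqrt_nonneg _), Complex.ofReal_inv,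
      inv_pow, pow_two, hsq]
  simp only [dotProduct, Pi.star_apply, hterm]
  simp [hd]

theorem clonedKet_dotProduct {d : ℕ} [NeZero d] (θ : Phases d) :
    star (clonedKet d θ) ⬝ᵥ clonedKet d θ = 1 := by
  have h := phaseKet_dotProduct θ
  simp only [dotProduct, Pi.star_apply] at h
  simp only [dotProduct, Pi.star_apply, clonedKet, star_mul', Fintype.sum_prod_type]
  calc _ = (∑ k, star (phaseKet d θ k) * phaseKet d θ k) *
        ∑ l, star (phaseKet d θ l) * phaseKet d θ l := by
        rw [Finset.sum_mul_sum]
        exact Finset.sum_congr rfl fun k _ => Finset.sum_congr rfl fun l _ => by ring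
    _ = 1 := by rw [h, one_mul]

/-- The Fourier expansion of the amplitude `⟨θ, θ| K |θ⟩`. -/
theorem clonedKet_dotProduct_mulVec {d : ℕ} (K : Matrix (Fin d × Fin d) (Fin d) ℂ)
    (θ : Phases d) :
    star (clonedKet d θ) ⬝ᵥ K *ᵥ phaseKet d θ =
      ((Real.sqrt d)⁻¹ : ℂ) ^ 3 * ∑ a, K a.1 a.2 * torusChar (transitionMode a) θ := by
  simp only [dotProduct, mulVec, Pi.star_apply, Finset.mul_sum]
  rw [← Fintype.sum_prod_type' (f := fun s m =>
    star (clonedKet d θ s) * (K s m * phaseKet d θ m))]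
  refine Finset.sum_congr rfl fun a _ => ?_
  simp only [clonedKet, phaseKet, transitionMode, sub_eq_add_neg, torusChar_add, torusChar_neg,
    torusChar_single, star_mul']
  simp only [← starRingEnd_apply, map_inv₀, Complex.conj_ofReal]
  ring

theorem fidelity_phaseState_kraus {d : ℕ} [NeZero d] {κ : Type*} [Fintype κ]
    (K : κ → Matrix (Fin d × Fin d) (Fin d) ℂ) (θ : Phases d) :
    fidelity (idealCloner d (phaseState d θ)) (∑ q, K q * phaseState d θ * (K q)ᴴ) =
      ((d : ℝ) ^ 3)⁻¹ * ∑ q, ‖∑ a, K q a.1 a.2 * torusChar (transitionMode a) θ‖ ^ 2 := by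
  rw [idealCloner_phaseState, phaseState, fidelity_kraus _ (clonedKet_dotProduct θ),
    Finset.mul_sum]
  refine Finset.sum_congr rfl fun q _ => ?_
  rw [clonedKet_dotProduct_mulVec, norm_mul, mul_pow, norm_pow, norm_inv, Complex.norm_real,
    Real.norm_of_nonneg (Real.sqrt_nonneg _), ← pow_mul, mul_comm 3 2, pow_mul, inv_pow,
    Real.sq_sqrt (Nat.cast_nonneg d), inv_pow]

/-- Trace preservation, evaluated at the identity, fixes the total weight of the Kraus operators. -/
theorem sum_normSq_kraus {n m κ : Type*} [Fintype n] [DecidableEq n] [Fintype m] [DecidableEq m]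
    [Fintype κ] (E : Channel n m) (K : κ → Matrix m n ℂ)
    (hK : ∀ X, E X = ∑ q, K q * X * (K q)ᴴ) :
    ∑ q, ∑ a : m × n, ‖K q a.1 a.2‖ ^ 2 = Fintype.card n := by
  have h := E.trace_map' 1
  rw [hK, Matrix.trace_one] at h
  rw [← Complex.ofReal_inj, Complex.ofReal_natCast, ← h, Matrix.trace_sum, Complex.ofReal_sum]
  refine Finset.sum_congr rfl fun q _ => ?_
  simp [Matrix.trace, Matrix.mul_apply, Fintype.sum_prod_type, Complex.mul_conj']

/-! ### The upper bound -/

theorem integrable_fidelity {d : ℕ} [NeZero d] (E : Channel (Fin d) (Fin d × Fin d)) :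
    Integrable (fun θ => fidelity (idealCloner d (phaseState d θ)) (E (phaseState d θ)))
      (phaseHaar d) := by
  obtain ⟨K, hK⟩ := E.exists_kraus
  simp_rw [hK, fidelity_phaseState_kraus]
  exact integrable_of_continuous (by fun_prop)

theorem processFidelity_le {d : ℕ} [NeZero d] (E : Channel (Fin d) (Fin d × Fin d)) :
    processFidelity (phaseHaar d) (phaseState d) (idealCloner d) E ≤
      (2 * (d : ℝ) - 1) / (d : ℝ) ^ 2 := by
  have hd : 0 < d := NeZero.pos d
  obtain ⟨K, hK⟩ := E.exists_kraus
  have hN : ((2 * d - 1 : ℕ) : ℝ) = 2 * (d : ℝ) - 1 := by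
    rw [Nat.cast_sub (by omega)]; push_cast; ring
  simp_rw [processFidelity, hK, fidelity_phaseState_kraus]
  rw [integral_const_mul, integral_finsetSum _ fun q _ => integrable_of_continuous (by fun_prop)]
  calc _ ≤ ((d : ℝ) ^ 3)⁻¹ * ∑ q, ((2 * d - 1 : ℕ) : ℝ) * ∑ a : (Fin d × Fin d) × Fin d,
        ‖K q a.1 a.2‖ ^ 2 := by
        gcongr with q
        exact integral_normSq_sum_torusChar_le _ _ card_transitionMode_le _
    _ = (2 * (d : ℝ) - 1) / (d : ℝ) ^ 2 := by
        rw [← Finset.mul_sum, sum_normSq_kraus E K hK, hN, Fintype.card_fin]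
        have : (d : ℝ) ≠ 0 := by positivity
        field_simp

/-! ### A channel attaining the bound -/

/-- The Kraus operator `|m⟩ ↦ c (|m, j⟩ + |j, m⟩)` for `m ≠ j` and `|j⟩ ↦ c |j, j⟩`, where
`c = 1 / √(2 d - 1)`. All its transitions have the frequency `-e_j` and the same weight. -/
noncomputable def cloningKraus {d : ℕ} (j : Fin d) : Matrix (Fin d × Fin d) (Fin d) ℂ :=
  Matrix.of fun s m => if s ∈ cloningPairs m j then ((Real.sqrt (2 * d - 1))⁻¹ : ℂ) else 0

theorem sqrt_mul_self_two_mul_sub_one {d : ℕ} [NeZero d] :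
    (Real.sqrt (2 * d - 1) : ℂ) * Real.sqrt (2 * d - 1) = ((2 * d - 1 : ℕ) : ℂ) := by
  have hd : 0 < d := NeZero.pos d
  have hN : ((2 * d - 1 : ℕ) : ℝ) = 2 * (d : ℝ) - 1 := by
    rw [Nat.cast_sub (by omega)]; push_cast; ring
  rw [← hN, ← Complex.ofReal_mul, Real.mul_self_sqrt (Nat.cast_nonneg _), Complex.ofReal_natCast]

theorem mem_cloningPairs_unique {d : ℕ} {s : Fin d × Fin d} {m m' j : Fin d}
    (h : s ∈ cloningPairs m j) (h' : s ∈ cloningPairs m' j) : m = m' := by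
  simp only [cloningPairs, Finset.mem_insert, Finset.mem_singleton, Prod.ext_iff] at h h'
  grind

theorem cloningPairs_comm {d : ℕ} (m j : Fin d) : cloningPairs m j = cloningPairs j m := by
  rw [cloningPairs, cloningPairs, Finset.pair_comm]

theorem sum_cloningKraus {d : ℕ} [NeZero d] :
    ∑ j, (cloningKraus j)ᴴ * cloningKraus j = (1 : Matrix (Fin d) (Fin d) ℂ) := by
  have hd : 0 < d := NeZero.pos d
  have hs := sqrt_mul_self_two_mul_sub_one (d := d)
  ext m m'
  simp only [Matrix.sum_apply, Matrix.mul_apply, conjTranspose_apply, cloningKraus, of_apply]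
  by_cases h : m = m'
  · subst h
    have hterm : ∀ (j : Fin d) (s : Fin d × Fin d),
        star (if s ∈ cloningPairs m j then ((Real.sqrt (2 * d - 1))⁻¹ : ℂ) else 0) *
          (if s ∈ cloningPairs m j then ((Real.sqrt (2 * d - 1))⁻¹ : ℂ) else 0) =
        if s ∈ cloningPairs m j then ((2 * d - 1 : ℕ) : ℂ)⁻¹ else 0 := fun j s => by
      split_ifs
      · rw [← hs, ← starRingEnd_apply, map_inv₀, Complex.conj_ofReal, mul_inv]
      · simp
    simp_rw [hterm, ← Finset.sum_filter, Finset.sum_const, Finset.filter_univ_mem, nsmul_eq_mul,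
      ← Finset.sum_mul, cloningPairs_comm m]
    rw [← Nat.cast_sum, sum_card_cloningPairs, one_apply_eq, mul_inv_cancel₀]
    exact Nat.cast_ne_zero.mpr (by omega)
  · rw [one_apply_ne h]
    refine Finset.sum_eq_zero fun j _ => Finset.sum_eq_zero fun s _ => ?_
    split_ifs with h1 h2
    · exact absurd (mem_cloningPairs_unique h2 h1) (by tauto)
    all_goals simp

theorem transitionMode_of_mem {d : ℕ} {s : Fin d × Fin d} {m j : Fin d}
    (h : s ∈ cloningPairs m j) : transitionMode (s, m) = -Pi.single j 1 := by
  simp only [cloningPairs, Finset.mem_insert, Finset.mem_singleton] at h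
  rcases h with rfl | rfl <;> simp [transitionMode]

/-- The amplitude `⟨θ, θ| K |θ⟩` of `cloningKraus j` is, up to scaling, a single character, so its
modulus does not depend on `θ`. -/
theorem sum_cloningKraus_torusChar {d : ℕ} [NeZero d] (j : Fin d) (θ : Phases d) :
    ∑ a, cloningKraus j a.1 a.2 * torusChar (transitionMode a) θ =
      Real.sqrt (2 * d - 1) * star (AddCircle.toCircle (θ j) : ℂ) := by
  have hterm : ∀ a : (Fin d × Fin d) × Fin d,
      cloningKraus j a.1 a.2 * torusChar (transitionMode a) θ =
        if a.1 ∈ cloningPairs a.2 j then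
          ((Real.sqrt (2 * d - 1))⁻¹ : ℂ) * star (AddCircle.toCircle (θ j) : ℂ) else 0 := by
    rintro ⟨s, m⟩
    simp only [cloningKraus, of_apply]
    split_ifs with h
    · rw [transitionMode_of_mem h, torusChar_neg, torusChar_single]
    · simp
  have hs := sqrt_mul_self_two_mul_sub_one (d := d)
  have hne : (Real.sqrt (2 * d - 1) : ℂ) ≠ 0 := by
    intro h0
    have hd : 0 < d := NeZero.pos d
    rw [h0, mul_zero, eq_comm, Nat.cast_eq_zero] at hs
    omega
  simp_rw [hterm]
  rw [Fintype.sum_prod_type_right]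
  simp_rw [← Finset.sum_filter, Finset.sum_const, Finset.filter_univ_mem, nsmul_eq_mul]
  rw [← Finset.sum_mul, ← Nat.cast_sum, sum_card_cloningPairs, ← hs]
  field_simp

/-- The channel with Kraus operators `cloningKraus j`. -/
noncomputable def optimalCloner (d : ℕ) [NeZero d] : Channel (Fin d) (Fin d × Fin d) :=
  krausChannel cloningKraus sum_cloningKraus

theorem processFidelity_optimalCloner (d : ℕ) [NeZero d] :
    processFidelity (phaseHaar d) (phaseState d) (idealCloner d) (optimalCloner d) =
      (2 * (d : ℝ) - 1) / (d : ℝ) ^ 2 := by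
  have hd : (1 : ℝ) ≤ d := Nat.one_le_cast.mpr (NeZero.one_le)
  have hF : ∀ θ, fidelity (idealCloner d (phaseState d θ)) (optimalCloner d (phaseState d θ)) =
      (2 * (d : ℝ) - 1) / (d : ℝ) ^ 2 := fun θ => by
    refine (fidelity_phaseState_kraus cloningKraus θ).trans ?_
    simp_rw [sum_cloningKraus_torusChar, norm_mul, norm_star, Circle.norm_coe, mul_one,
      Complex.norm_real, Real.norm_of_nonneg (Real.sqrt_nonneg _)]
    rw [Real.sq_sqrt (by linarith), Finset.sum_const, Finset.card_univ, Fintype.card_fin,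
      nsmul_eq_mul]
    field_simp
  simp only [processFidelity, hF]
  simp

end QuantumCloning

theorem theorem1 (d : ℕ) (hd : 1 ≤ d) :
    (∀ E : QuantumCloning.Channel (Fin d) (Fin d × Fin d),
      Integrable (fun θ => QuantumCloning.fidelity
        (QuantumCloning.idealCloner d (QuantumCloning.phaseState d θ))
        (E (QuantumCloning.phaseState d θ))) (QuantumCloning.phaseHaar d)) ∧
    IsGreatest
      (Set.range fun E : QuantumCloning.Channel (Fin d) (Fin d × Fin d) =>
        QuantumCloning.processFidelity (QuantumCloning.phaseHaar d)
          (QuantumCloning.phaseState d) (QuantumCloning.idealCloner d) E)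
      ((2 * (d : ℝ) - 1) / (d : ℝ) ^ 2) := by
  have : NeZero d := ⟨by omega⟩
  refine ⟨QuantumCloning.integrable_fidelity,
    ⟨QuantumCloning.optimalCloner d, QuantumCloning.processFidelity_optimalCloner d⟩, ?_⟩
  rintro _ ⟨E, rfl⟩
  exact QuantumCloning.processFidelity_le E
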